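/- Let $G=(V,E)$ be a directed graph on $N=|V|\ge 2$ vertices that contains all self-loops, and let $T$ be a number of rounds. In the graph-feedback game the environment fixes, before the game starts, random losses $\ell_{t,i}\in[0,1]$ ($t\le T$, $i\in V$) with some joint law; in each round $t$ the learner draws an action $i_t\in V$ from a probability distribution that may depend on its past actions and observations, suffers $\ell_{t,i_t}$ and observes $\ell_{t,i}$ for all $i$ with $(i_t,i)\in E$. Its regret is $R_T=\max_{i\in V}\mathbb E\big[\sum_{t\le T}(\ell_{t,i_t}-\ell_{t,i})\big]$. For $I\subseteq V$ and $\Delta\in(0,1/2]$ let $\Pi_{I,\Delta}$ be the set of all $\pi\in\mathbb R_{\ge0}^V$ with $\sum_i\pi_i\le1$ and $T\sum_{i:(i,j)\in E}\pi_i\ge 1/\Delta^2$ for all $j\in I$, and let $$Q^*_{I,\Delta}=\min_{\pi\in\Pi_{I,\Delta}}\min\Big[T\sum_{i\in I}\pi_i\Delta+T\sum_{i\notin I}\pi_i,\;T\Delta\Big],\qquad Q^*=\max_{I\subseteq V}\sup_{\Delta\in(0,1/2]}Q^*_{I,\Delta},$$ where $Q^*_{I,\Delta}=T\Delta$ if $\Pi_{I,\Delta}=\emptyset$.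 For $A,B\subseteq V$ let $\delta^A(B)$ be the least size of a set $D\subseteq A$ such that every $j\in B$ has some $i\in D$ with $(i,j)\in E$ ($\infty$ if there is none), and let $$R^*=\max_{I\subseteq V}\min_{J\subseteq I}\max\big\{\delta^I(J)^{1/2}T^{1/2},\ \delta^V(I\setminus J)^{1/3}T^{2/3}\big\}.$$ Then for every learner there is a random sequence of losses in $[0,1]$ on which its regret satisfies $$R_T\ \ge\ \frac{Q^*}{2^7}\ \ge\ \frac1{2^7}\min\Big\{\frac{R^*}{10\log N},\ \frac T2\Big\}.$$ In particular $R_T\ge Q^*/2^7\ge R^*/(2^7\cdot 10\log N)$ whenever $R^*\le 5\,T\log N$, which holds for instance if $T\ge N$. -/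

import Mathlib

open scoped ENNReal

noncomputable section

namespace GraphFeedback

variable {V : Type*} [Fintype V]

/-- What the learner has seen when it has played `past` in the first `t` rounds and the losses in
these rounds were `loss`: in each round the losses of all out-neighbours of the played action.
Entries that were not observed are replaced by the uninformative value `0`; the learner knows
the graph and its own actions, hence knows which entries these are. -/
def observed (G : Digraph V) {t : ℕ} (past : Fin t → V) (loss : Fin t → V → ℝ) :
    Fin t → V → ℝ :=
  open Classical in fun s i => if G.Adj (past s) i then loss s i else 0

/-- A (randomized, adaptive) learner for `T` rounds: in round `t`, given its past actions and
past observations, it draws its action from the probability vector `prob t past obs`, which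
depends measurably on the observed losses. -/
structure Learner (V : Type*) [Fintype V] (T : ℕ) where
  prob : (t : Fin T) → (Fin (t : ℕ) → V) → (Fin (t : ℕ) → V → ℝ) → V → ℝ
  prob_nonneg : ∀ t past obs i, 0 ≤ prob t past obs i
  prob_sum : ∀ t past obs, ∑ i, prob t past obs i = 1
  measurable_prob : ∀ t past i, Measurable fun obs => prob t past obs i

/-- The restriction of a sequence indexed by the `T` rounds to the rounds before round `t`. -/
def before {α : Type*} {T : ℕ} (x : Fin T → α) (t : Fin T) : Fin (t : ℕ) → α :=
  fun s => x ⟨s, s.2.trans t.2⟩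

/-- The probability that the learner plays the action sequence `a` when the losses are `ℓ` and
the feedback graph is `G`. -/
def Learner.playProb {T : ℕ} (L : Learner V T) (G : Digraph V) (ℓ : Fin T → V → ℝ)
    (a : Fin T → V) : ℝ :=
  ∏ t, L.prob t (before a t) (observed G (before a t) (before ℓ t)) (a t)

/-- The regret `max_i E[∑_t (ℓ_{t, i_t} - ℓ_{t, i})]`: the losses have law `μ` and are fixed
before the game starts, and the actions are drawn by the learner. -/
def Learner.regret {T : ℕ} (L : Learner V T) (G : Digraph V)
    (μ : MeasureTheory.Measure (Fin T → V → ℝ)) : ℝ :=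
  ⨆ i : V, ∫ ℓ, ∑ a : Fin T → V, L.playProb G ℓ a * ∑ t, (ℓ t (a t) - ℓ t i) ∂μ

/-- `D` dominates `B` from `A`. -/
def Dominates (G : Digraph V) (A B D : Finset V) : Prop :=
  D ⊆ A ∧ ∀ j ∈ B, ∃ i ∈ D, G.Adj i j

/-- The dominating number `δ^A(B)`; it is `∞` if no subset of `A` dominates `B`. -/
def dominatingNumber (G : Digraph V) (A B : Finset V) : ℕ∞ :=
  ⨅ (D : Finset V) (_ : Dominates G A B D), (D.card : ℕ∞)

/-- The problem complexity `R*_I`. -/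
def complexityROn (G : Digraph V) (T : ℕ) (I : Finset V) : ℝ≥0∞ :=
  open Classical in
  ⨅ (J : Finset V) (_ : J ⊆ I),
    max ((dominatingNumber G I J : ℝ≥0∞) ^ (1 / 2 : ℝ) * (T : ℝ≥0∞) ^ (1 / 2 : ℝ))
      ((dominatingNumber G Finset.univ (I \ J) : ℝ≥0∞) ^ (1 / 3 : ℝ) * (T : ℝ≥0∞) ^ (2 / 3 : ℝ))

/-- The problem complexity `R*`. -/
def complexityR (G : Digraph V) (T : ℕ) : ℝ≥0∞ :=
  ⨆ I : Finset V, complexityROn G T I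

/-- The set `Π` of (sub)probability vectors `π` that observe every action of `I` at least
`1/Δ²` times in expectation over `T` rounds. -/
def feasible (G : Digraph V) (T : ℕ) (I : Finset V) (Δ : ℝ) : Set (V → ℝ) :=
  open Classical in
  {π | (∀ i, 0 ≤ π i) ∧ ∑ i, π i ≤ 1 ∧
    ∀ j ∈ I, 1 / Δ ^ 2 ≤ (T : ℝ) * ∑ i, π i * (if G.Adj i j then 1 else 0)}

/-- The problem complexity `Q*_{I,Δ}`; if no vector is feasible, it is the bound `TΔ` that caps
the objective. -/
def complexityQAt (G : Digraph V) (T : ℕ) (I : Finset V) (Δ : ℝ) : ℝ :=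
  open Classical in
  if (feasible G T I Δ).Nonempty then
    sInf ((fun π : V → ℝ =>
      min ((T : ℝ) * ∑ i ∈ I, π i * Δ + (T : ℝ) * ∑ i ∈ Iᶜ, π i) ((T : ℝ) * Δ)) ''
        feasible G T I Δ)
  else (T : ℝ) * Δ

/-- The problem complexity `Q*_I`. -/
def complexityQOn (G : Digraph V) (T : ℕ) (I : Finset V) : ℝ :=
  sSup (complexityQAt G T I '' Set.Ioc 0 (1 / 2))

/-- The problem complexity `Q*`. -/
def complexityQ (G : Digraph V) (T : ℕ) : ℝ :=
  ⨆ I : Finset V, complexityQOn G T I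

/-- With all self-loops present, every dominating number in the definition of `R*` that matters
is finite, hence so is `R*`. -/
theorem complexityR_ne_top (G : Digraph V) (hG : ∀ v, G.Adj v v) (T : ℕ) :
    complexityR G T ≠ ⊤ := by
  have hdom : ∀ A B : Finset V, B ⊆ A → (dominatingNumber G A B : ℝ≥0∞) ≠ ⊤ := by
    intro A B h
    have h1 : dominatingNumber G A B ≤ (B.card : ℕ∞) :=
      iInf₂_le B ⟨h, fun j hj => ⟨j, hj, hG j⟩⟩
    have h2 : dominatingNumber G A B ≠ ⊤ := ne_top_of_le_ne_top (ENat.natCast_ne_top _) h1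
    simpa using h2
  have hI : ∀ I : Finset V, complexityROn G T I < ⊤ := by
    intro I
    simp only [complexityROn, iInf_lt_iff]
    refine ⟨I, Finset.Subset.refl I, ?_⟩
    refine max_lt ?_ ?_
    · exact ENNReal.mul_lt_top
        (ENNReal.rpow_lt_top_of_nonneg (by norm_num) (hdom _ _ (Finset.Subset.refl I)))
        (ENNReal.rpow_lt_top_of_nonneg (by norm_num) (ENNReal.natCast_ne_top T))
    · exact ENNReal.mul_lt_top
        (ENNReal.rpow_lt_top_of_nonneg (by norm_num) (hdom _ _ (Finset.subset_univ _)))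
        (ENNReal.rpow_lt_top_of_nonneg (by norm_num) (ENNReal.natCast_ne_top T))
  obtain ⟨I, h⟩ := Finite.exists_max (fun I : Finset V => complexityROn G T I)
  exact (lt_of_le_of_lt (iSup_le h) (hI I)).ne

end GraphFeedback

end

noncomputable section

namespace GraphFeedback

open scoped Classical
open Finset Function

/-! Lower bound on the regret. Suppose the expected regret is at most `M` on every loss sequence in
`[0,1]` and against every action; it suffices to get `complexityQAt G T I Δ ≤ 100 * M`. Pick `k ∈ I`
with constant loss `1/2 - Δ/4`, let `S` be the actions of `I` not observed by `k`, give them fair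
`0/1` losses, and give everything else loss `1`. Under the fair law the regret against `k` is the
cost of exploration, so the expected play counts off `k` are cheap (`hardCount_explore_le`). If
every `j ∈ S` were observed of order `1/Δ²` times, rescaled counts plus a little mass on `k` would
be a feasible vector with too small an objective. So some `j ∈ S` is rarely observed. Shifting the
mean loss of `j` to `1/2 - Δ/2` is then hardly noticed, and the learner misses `j` in most rounds,
paying at least `Δ/4` each time (`hardCount_confuse_le`). The change of measure is elementary:
unobserved signs integrate out of the likelihood ratio, and what remains is bounded below pointwise
by a quadratic in the sum of observed signs. These are martingale differences, so the second moment
of that sum is the expected number of observations. Comparison of `Q*` with `R*`. If `Q* < T/2`, a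
scale `Δ` of order `Q*/T` admits a feasible vector with objective below `T * Δ`. Doubled, it
fractionally covers each action of `I` either from inside or from outside `I`; greedy set cover
rounds both parts at the price of a logarithm (`exists_dominates_of_feasible`). -/

theorem sum_sum_update {ι α : Type*} [Fintype ι] [DecidableEq ι] [Fintype α] (k : ι)
    (F : (ι → α) → ℝ) :
    ∑ a : ι → α, ∑ i, F (update a k i) = Fintype.card α * ∑ a, F a := by
  -- Swapping the coordinate `k` with the spare value is an involution.
  let e : (ι → α) × α ≃ (ι → α) × α :=
    { toFun := fun p => (update p.1 k p.2, p.1 k)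
      invFun := fun p => (update p.1 k p.2, p.1 k)
      left_inv := fun p => by simp
      right_inv := fun p => by simp }
  calc ∑ a : ι → α, ∑ i, F (update a k i) = ∑ p : (ι → α) × α, F (e p).1 := by
        rw [Fintype.sum_prod_type]; rfl
    _ = ∑ p : (ι → α) × α, F p.1 := Equiv.sum_comp e fun p => F p.1
    _ = _ := by
        rw [Fintype.sum_prod_type]
        simp [Finset.mul_sum]

/-- `F` does not depend on the coordinate `k` of its argument. -/
def IndepOf {ι α : Type*} [DecidableEq ι] (F : (ι → α) → ℝ) (k : ι) : Prop :=
  ∀ a i, F (update a k i) = F a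

/-! ### The law of the action sequence and its causality -/

section Play

variable {V : Type*} [Fintype V] {T : ℕ} (L : Learner V T) (G : Digraph V)

/-- The probability of the action sequence `a` if the learner plays for `n` rounds and draws
uniform actions afterwards. -/
def Learner.truncProb (ℓ : Fin T → V → ℝ) (n : ℕ) (a : Fin T → V) : ℝ :=
  ∏ t : Fin T, if (t : ℕ) < n then
    L.prob t (before a t) (observed G (before a t) (before ℓ t)) (a t)
    else (Fintype.card V : ℝ)⁻¹

theorem playProb_eq_truncProb (ℓ : Fin T → V → ℝ) (a : Fin T → V) :
    L.playProb G ℓ a = L.truncProb G ℓ T a := by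
  simp [Learner.playProb, Learner.truncProb]

theorem before_update {α : Type*} (a : Fin T → α) {t k : Fin T} (h : t ≤ k) (i : α) :
    before (update a k i) t = before a t := by
  funext s
  have : (⟨s, s.2.trans t.2⟩ : Fin T) ≠ k := by
    intro h'
    have h1 := congrArg Fin.val h'
    have h2 : (t : ℕ) ≤ k := h
    have := s.2
    simp at h1
    omega
  simp [before, update_of_ne this]

/-- Averaged over the coordinate `k`, the learner's factor and the uniform factor both sum to one.
No earlier factor sees this coordinate, and later factors are constant. -/
theorem sum_truncProb_succ [Nonempty V] (ℓ : Fin T → V → ℝ) (k : Fin T) (f : (Fin T → V) → ℝ)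
    (hf : IndepOf f k) :
    ∑ a, L.truncProb G ℓ (k + 1) a * f a = ∑ a, L.truncProb G ℓ k a * f a := by
  have hN : (Fintype.card V : ℝ) ≠ 0 := by simp
  have h := sum_sum_update k fun a => L.truncProb G ℓ (k + 1) a * f a
  apply mul_left_cancel₀ hN
  rw [← h, mul_sum]
  refine sum_congr rfl fun a _ => ?_
  have key : ∀ i, L.truncProb G ℓ (k + 1) (update a k i) =
      L.prob k (before a k) (observed G (before a k) (before ℓ k)) i *
        ∏ t ∈ univ.erase k, if (t : ℕ) < k then
          L.prob t (before a t) (observed G (before a t) (before ℓ t)) (a t)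
          else (Fintype.card V : ℝ)⁻¹ := by
    intro i
    rw [Learner.truncProb, ← mul_prod_erase univ _ (mem_univ k)]
    congr 1
    · simp [before_update]
    · refine prod_congr rfl fun t ht => ?_
      have htk : t ≠ k := ne_of_mem_erase ht
      have hne : (t : ℕ) ≠ k := fun h => htk (Fin.ext h)
      by_cases h1 : (t : ℕ) < k
      · have h2 : (t : ℕ) < k + 1 := by omega
        simp only [h1, h2, if_true, update_of_ne htk]
        rw [before_update a (show t ≤ k from h1.le)]
      · have h2 : ¬ (t : ℕ) < k + 1 := by omega
        simp only [h1, h2, if_false]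
  have key2 : L.truncProb G ℓ k a = (Fintype.card V : ℝ)⁻¹ *
        ∏ t ∈ univ.erase k, if (t : ℕ) < k then
          L.prob t (before a t) (observed G (before a t) (before ℓ t)) (a t)
          else (Fintype.card V : ℝ)⁻¹ := by
    rw [Learner.truncProb, ← mul_prod_erase univ _ (mem_univ k)]
    simp
  simp_rw [key, hf a, key2, ← sum_mul, L.prob_sum]
  field_simp

theorem sum_playProb_eq_truncProb [Nonempty V] (ℓ : Fin T → V → ℝ) (n : ℕ) (hn : n ≤ T)
    (f : (Fin T → V) → ℝ) (hf : ∀ k : Fin T, n ≤ k → IndepOf f k) :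
    ∑ a, L.playProb G ℓ a * f a = ∑ a, L.truncProb G ℓ n a * f a := by
  simp_rw [playProb_eq_truncProb]
  have : ∀ m, n ≤ m → m ≤ T →
      ∑ a, L.truncProb G ℓ m a * f a = ∑ a, L.truncProb G ℓ n a * f a := by
    intro m hm
    induction m, hm using Nat.le_induction with
    | base => intro _; rfl
    | succ m hm ih =>
      intro h
      rw [← ih (by omega)]
      exact sum_truncProb_succ L G ℓ ⟨m, h⟩ f (hf _ hm)
  exact this T hn le_rfl

theorem sum_playProb [Nonempty V] (ℓ : Fin T → V → ℝ) : ∑ a, L.playProb G ℓ a = 1 := by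
  have := sum_playProb_eq_truncProb L G ℓ 0 (Nat.zero_le _) (fun _ => 1) fun _ _ _ _ => rfl
  simp only [mul_one] at this
  rw [this]
  simp [Learner.truncProb]

theorem playProb_nonneg (ℓ : Fin T → V → ℝ) (a : Fin T → V) : 0 ≤ L.playProb G ℓ a :=
  prod_nonneg fun _ _ => L.prob_nonneg _ _ _ _

/-- The actions up to round `t` only depend on the losses before round `t`. -/
theorem sum_playProb_congr [Nonempty V] {ℓ ℓ' : Fin T → V → ℝ} (t : Fin T)
    (hℓ : ∀ s < t, ℓ s = ℓ' s) (f : (Fin T → V) → ℝ) (hf : ∀ k, t < k → IndepOf f k) :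
    ∑ a, L.playProb G ℓ a * f a = ∑ a, L.playProb G ℓ' a * f a := by
  rw [sum_playProb_eq_truncProb L G ℓ (t + 1) t.2 f fun k hk => hf k hk,
    sum_playProb_eq_truncProb L G ℓ' (t + 1) t.2 f fun k hk => hf k hk]
  refine sum_congr rfl fun a _ => ?_
  congr 1
  refine prod_congr rfl fun s _ => ?_
  split_ifs with hs
  · have : before ℓ s = before ℓ' s := by
      funext r
      apply hℓ
      have := r.2
      show (r : ℕ) < t
      omega
    rw [this]
  · rfl

/-- Losses that are not observed do not matter. -/
theorem playProb_congr {ℓ ℓ' : Fin T → V → ℝ} (a : Fin T → V)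
    (h : ∀ t i, G.Adj (a t) i → ℓ t i = ℓ' t i) :
    L.playProb G ℓ a = L.playProb G ℓ' a := by
  refine prod_congr rfl fun t _ => ?_
  have : observed G (before a t) (before ℓ t) = observed G (before a t) (before ℓ' t) := by
    funext s i
    simp only [observed]
    split_ifs with hs
    · exact h _ _ hs
    · rfl
  rw [this]

/-- The expected regret against the action `c` when the losses are `ℓ`. -/
def Learner.gain (ℓ : Fin T → V → ℝ) (c : V) : ℝ :=
  ∑ a : Fin T → V, L.playProb G ℓ a * ∑ t, (ℓ t (a t) - ℓ t c)

end Play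

/-! ### Random signs and likelihood ratios -/

section Signs

/-- The sign of a bit. -/
def sgn (v : Bool) : ℝ := if v then 1 else -1

theorem sgn_sq (v : Bool) : sgn v ^ 2 = 1 := by cases v <;> simp [sgn]

theorem sgn_mem (v : Bool) : -1 ≤ sgn v ∧ sgn v ≤ 1 := by cases v <;> simp [sgn]

theorem sum_mul_sgn {ι : Type*} [Fintype ι] [DecidableEq ι] (c : ι) (F : (ι → Bool) → ℝ) (hF : IndepOf F c) :
    ∑ b, F b * sgn (b c) = 0 := by
  have h := sum_sum_update c fun b => F b * sgn (b c)
  simp only [hF _ _, update_self] at h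
  simpa [sgn] using h

theorem IndepOf.mul {ι α : Type*} [DecidableEq ι] {F H : (ι → α) → ℝ} {k : ι} (hF : IndepOf F k)
    (hH : IndepOf H k) : IndepOf (fun a => F a * H a) k := fun a i => by
  simp only [hF a i, hH a i]

theorem IndepOf.prod {ι κ α : Type*} [DecidableEq ι] {F : κ → (ι → α) → ℝ} {k : ι} (s : Finset κ)
    (hF : ∀ x ∈ s, IndepOf (F x) k) : IndepOf (fun a => ∏ x ∈ s, F x a) k := fun a i =>
  prod_congr rfl fun x hx => hF x hx a i

theorem indepOf_comp {ι α : Type*} [DecidableEq ι] (g : α → ℝ) {c k : ι} (h : c ≠ k) :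
    IndepOf (fun a : ι → α => g (a c)) k := fun a i => by
  simp only [update_of_ne h]

variable {V : Type*} {T : ℕ}

/-- The likelihood ratio, restricted to the rounds in `U`, of the signs of the action `j` having
mean `β` to their being fair. -/
def tilt (β : ℝ) (j : V) (U : Finset (Fin T)) (b : Fin T × V → Bool) : ℝ :=
  ∏ t ∈ U, (1 + β * sgn (b (t, j)))

theorem tilt_nonneg {β : ℝ} (h0 : 0 ≤ β) (h1 : β ≤ 1) (j : V) (U : Finset (Fin T))
    (b : Fin T × V → Bool) : 0 ≤ tilt β j U b :=
  prod_nonneg fun t _ => by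
    have := sgn_mem (b (t, j))
    nlinarith

theorem indepOf_tilt (β : ℝ) (j : V) (U : Finset (Fin T)) (c : Fin T × V)
    (h : ∀ t ∈ U, (t, j) ≠ c) : IndepOf (tilt β j U) c :=
  IndepOf.prod U fun t ht => indepOf_comp (fun v => 1 + β * sgn v) (h t ht)

variable [Fintype V]

/-- Multiply out the factors of `U` one at a time: the sign of each round is fair and independent of
all that remains, so its linear term vanishes. -/
theorem sum_tilt_union (β : ℝ) (j : V) (W U : Finset (Fin T)) (hd : Disjoint U W)
    (F : (Fin T × V → Bool) → ℝ) (hF : ∀ t ∈ U, IndepOf F (t, j)) :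
    ∑ b, tilt β j (U ∪ W) b * F b = ∑ b, tilt β j W b * F b := by
  induction U using Finset.induction_on with
  | empty => simp
  | insert t U ht ih =>
    have hd' := disjoint_insert_left.1 hd
    rw [← ih hd'.2 fun s hs => hF s (mem_insert_of_mem hs)]
    have hnot : t ∉ U ∪ W := by simp [ht, hd'.1]
    have h0 : ∑ b, (tilt β j (U ∪ W) b * F b) * sgn (b (t, j)) = 0 := by
      refine sum_mul_sgn (t, j) _ (IndepOf.mul (indepOf_tilt _ _ _ _ ?_)
        (hF t (mem_insert_self _ _)))
      rintro s hs h
      simp only [Prod.mk.injEq, and_true] at h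
      exact hnot (h ▸ hs)
    have h1 : ∀ b, tilt β j (insert t U ∪ W) b * F b =
        tilt β j (U ∪ W) b * F b + β * ((tilt β j (U ∪ W) b * F b) * sgn (b (t, j))) := by
      intro b
      rw [insert_union, tilt, prod_insert hnot, ← tilt]
      ring
    simp_rw [h1, sum_add_distrib, ← mul_sum, h0]
    ring

theorem sum_tilt (β : ℝ) (j : V) :
    ∑ b, tilt (T := T) β j univ b = Fintype.card (Fin T × V → Bool) := by
  have := sum_tilt_union β j ∅ (univ : Finset (Fin T)) (by simp) (fun _ => 1)
    fun _ _ _ _ => rfl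
  simpa [tilt] using this

/-- As `s ^ 2 = 1` for a sign, `(1 + β * s) * (s - β) = (1 - β ^ 2) * s`, which is centred under the
fair law. -/
theorem sum_tilt_mul_sgn_sub (β : ℝ) (j i : V) (t : Fin T) (F : (Fin T × V → Bool) → ℝ)
    (hF : IndepOf F (t, i)) :
    ∑ b, tilt β j univ b * F b * (sgn (b (t, i)) - if i = j then β else 0) = 0 := by
  split_ifs with hij
  · subst hij
    have h0 := sum_mul_sgn (t, i) (fun b => tilt β i (univ.erase t) b * F b)
      (IndepOf.mul (indepOf_tilt _ _ _ _ (by simp)) hF)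
    rw [← mul_zero (1 - β ^ 2), ← h0, mul_sum]
    refine sum_congr rfl fun b _ => ?_
    rw [tilt, ← mul_prod_erase univ _ (mem_univ t), ← tilt]
    linear_combination (tilt β i (univ.erase t) b * F b * β) * sgn_sq (b (t, i))
  · simp only [sub_zero]
    refine sum_mul_sgn (t, i) _ (IndepOf.mul (indepOf_tilt _ _ _ _ ?_) hF)
    simp [Ne.symm hij]

theorem exp_sub_sq_le {x : ℝ} (h0 : -(1 / 2) ≤ x) : Real.exp (x - x ^ 2) ≤ 1 + x := by
  have hpos : 0 < 1 + x := by linarith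
  suffices h : 1 / (1 + x) ≤ Real.exp (x ^ 2 - x) by
    rw [show x - x ^ 2 = -(x ^ 2 - x) by ring, Real.exp_neg]
    rw [inv_le_comm₀ (Real.exp_pos _) hpos]
    simpa using h
  rw [div_le_iff₀ hpos]
  rcases le_total 0 x with hx | hx
  -- Here `(1 + x) * (1 - x + x ^ 2) = 1 + x ^ 3` suffices; negative `x` needs the quadratic Taylor
  -- term.
  · have := Real.add_one_le_exp (x ^ 2 - x)
    nlinarith [pow_nonneg hx 3]
  · have h1 : 0 ≤ x ^ 2 - x := by nlinarith
    have h2 := Real.quadratic_le_exp_of_nonneg h1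
    have h3 : 1 ≤ (1 + (x ^ 2 - x) + (x ^ 2 - x) ^ 2 / 2) * (1 + x) := by
      have : 0 ≤ x ^ 2 * (1 + x * (1 + (- x * (1 + x)))) := by
        have hq : 0 ≤ -x * (1 + x) := by nlinarith
        have hq2 : -x * (1 + x) ≤ 1 := by nlinarith
        have : 0 ≤ 1 + x * (1 + (- x * (1 + x))) := by nlinarith
        positivity
      nlinarith [sq_nonneg x, sq_nonneg (x^2), mul_nonneg (sq_nonneg x) (neg_nonneg.2 hx)]
    exact h3.trans (mul_le_mul_of_nonneg_right h2 hpos.le)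

theorem one_add_sum_sub_sum_sq_le_prod {ι : Type*} (s : Finset ι) (x : ι → ℝ)
    (h : ∀ i ∈ s, -(1 / 2) ≤ x i) :
    1 + ∑ i ∈ s, x i - ∑ i ∈ s, x i ^ 2 ≤ ∏ i ∈ s, (1 + x i) := by
  have h1 : Real.exp (∑ i ∈ s, (x i - x i ^ 2)) ≤ ∏ i ∈ s, (1 + x i) := by
    rw [Real.exp_sum]
    exact prod_le_prod (fun _ _ => (Real.exp_pos _).le) fun i hi => exp_sub_sq_le (h i hi)
  have h2 := Real.add_one_le_exp (∑ i ∈ s, (x i - x i ^ 2))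
  rw [sum_sub_distrib] at h1 h2
  linarith

end Signs

/-! ### The hard environment and the change of measure -/

section Environment

variable {V : Type*} {T : ℕ}

/-- The losses in the hard environment: the action `k` has a constant loss slightly below `1 / 2`,
the actions in `S` have losses in `{0, 1}` given by the bits `b`, and all others have loss `1`. -/
def hardLoss (k : V) (S : Finset V) (Δ : ℝ) (b : Fin T × V → Bool) (t : Fin T) (i : V) : ℝ :=
  if i = k then 1 / 2 - Δ / 4 else if i ∈ S then (1 - sgn (b (t, i))) / 2 else 1

/-- The mean losses in the hard environment if the signs of `j` have mean `β` and the signs of all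
other actions are fair. -/
def hardMean (k : V) (S : Finset V) (Δ β : ℝ) (j i : V) : ℝ :=
  if i = k then 1 / 2 - Δ / 4 else if i ∈ S then (1 - if i = j then β else 0) / 2 else 1

theorem hardLoss_mem {Δ : ℝ} (h0 : 0 ≤ Δ) (h1 : Δ ≤ 1 / 2) (k : V) (S : Finset V)
    (b : Fin T × V → Bool) (t : Fin T) (i : V) : hardLoss k S Δ b t i ∈ Set.Icc (0 : ℝ) 1 := by
  have := sgn_mem (b (t, i))
  unfold hardLoss
  split_ifs <;> constructor <;> linarith

theorem hardLoss_update_of_ne (k : V) (S : Finset V) (Δ : ℝ) (b : Fin T × V → Bool)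
    (c : Fin T × V) (v : Bool) (t : Fin T) (i : V) (h : (t, i) ≠ c) :
    hardLoss k S Δ (update b c v) t i = hardLoss k S Δ b t i := by
  simp only [hardLoss, update_of_ne h]

/-- The product is at least `1 + β * s - β ^ 2 * #U`, with `s` the sum of signs. The linear term is
absorbed by `2 * (β * s + 1 / 4) ^ 2 ≥ 0`, leaving a square whose expectation is computable. -/
theorem sub_le_tilt_mul {β : ℝ} (h0 : 0 ≤ β) (h1 : β ≤ 1 / 2) (j : V) (U : Finset (Fin T))
    (b : Fin T × V → Bool) {X : ℝ} (hX : 0 ≤ X) (hX' : X ≤ T) :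
    X - T * (1 / 8 + 2 * β ^ 2 * (∑ t ∈ U, sgn (b (t, j))) ^ 2 + β ^ 2 * #U) ≤
      tilt β j U b * X := by
  have h := one_add_sum_sub_sum_sq_le_prod U (fun t => β * sgn (b (t, j))) fun t _ => by
    have := sgn_mem (b (t, j))
    nlinarith
  simp only [mul_pow, sgn_sq, ← mul_sum, mul_one, sum_const, nsmul_eq_mul] at h
  set s := ∑ t ∈ U, sgn (b (t, j))
  have h2 := mul_le_mul_of_nonneg_right h hX
  have h3 : 0 ≤ 1 / 8 + 2 * β ^ 2 * s ^ 2 + β ^ 2 * #U := by positivity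
  have h4 : -(1 / 8 + 2 * β ^ 2 * s ^ 2 + β ^ 2 * #U) ≤ β * s - #U * β ^ 2 := by
    nlinarith [sq_nonneg (β * s + 1 / 4)]
  have h5 := mul_le_mul_of_nonneg_right h4 hX
  have h6 := mul_le_mul_of_nonneg_right hX' h3
  unfold tilt
  nlinarith

variable [Fintype V]

theorem sum_tilt_mul_hardLoss_sub (k : V) (S : Finset V) (Δ β : ℝ) (j : V) (t : Fin T) (i : V)
    (F : (Fin T × V → Bool) → ℝ) (hF : IndepOf F (t, i)) :
    ∑ b, tilt β j univ b * (F b * (hardLoss k S Δ b t i - hardMean k S Δ β j i)) = 0 := by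
  unfold hardLoss hardMean
  split_ifs with h1 h2 h3
  · simp
  · have := sum_tilt_mul_sgn_sub β j i t F hF
    rw [if_pos h3] at this
    rw [← mul_zero (-(1 / 2) : ℝ), ← this, mul_sum]
    exact sum_congr rfl fun b _ => by ring
  · have := sum_tilt_mul_sgn_sub β j i t F hF
    rw [if_neg h3] at this
    simp only [sub_zero] at this ⊢
    rw [← mul_zero (-(1 / 2) : ℝ), ← this, mul_sum]
    exact sum_congr rfl fun b _ => by ring
  · simp

variable (L : Learner V T) (G : Digraph V) (k : V) (S : Finset V) (Δ : ℝ)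

/-- A bit of round `t` changes only the losses of that round, which are revealed after the action of
round `t` is drawn. -/
theorem indepOf_sum_playProb [Nonempty V] (t : Fin T) (i : V) (f : (Fin T → V) → ℝ)
    (hf : ∀ s, t < s → IndepOf f s) :
    IndepOf (fun b => ∑ a, L.playProb G (hardLoss k S Δ b) a * f a) (t, i) := by
  intro b v
  refine sum_playProb_congr L G t (fun s hs => ?_) f hf
  funext r
  refine hardLoss_update_of_ne _ _ _ _ _ _ _ _ fun h => ?_
  rw [Prod.mk.injEq] at h
  exact hs.ne h.1

theorem sum_tilt_mul_playProb_hardLoss_sub [Nonempty V] (β : ℝ) (j : V) (t : Fin T) :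
    ∑ b, tilt β j univ b * ∑ a, L.playProb G (hardLoss k S Δ b) a *
      (hardLoss k S Δ b t (a t) - hardMean k S Δ β j (a t)) = 0 := by
  have h : ∀ i, ∑ b, tilt β j univ b *
      ((∑ a, L.playProb G (hardLoss k S Δ b) a * if a t = i then 1 else 0) *
        (hardLoss k S Δ b t i - hardMean k S Δ β j i)) = 0 := by
    intro i
    refine sum_tilt_mul_hardLoss_sub k S Δ β j t i _
      (indepOf_sum_playProb L G k S Δ t i _ fun s hs => ?_)
    exact indepOf_comp (fun x => if x = i then 1 else 0) hs.ne
  rw [← sum_eq_zero fun i (_ : i ∈ univ) => h i, sum_comm]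
  refine sum_congr rfl fun b _ => ?_
  rw [← mul_sum]
  congr 1
  simp_rw [sum_mul]
  rw [sum_comm]
  refine sum_congr rfl fun a _ => ?_
  simp

theorem sum_tilt_mul_playProb_hardLoss_sub_const [Nonempty V] (β : ℝ) (j : V) (t : Fin T) (c : V) :
    ∑ b, tilt β j univ b * ∑ a, L.playProb G (hardLoss k S Δ b) a *
      (hardLoss k S Δ b t c - hardMean k S Δ β j c) = 0 := by
  simp_rw [← sum_mul, sum_playProb]
  exact sum_tilt_mul_hardLoss_sub k S Δ β j t c (fun _ => 1) fun _ _ => rfl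

/-- The expected regret in the hard environment. -/
theorem sum_tilt_mul_gain [Nonempty V] (β : ℝ) (j c : V) :
    ∑ b, tilt β j univ b * L.gain G (hardLoss k S Δ b) c =
      ∑ b, tilt β j univ b * ∑ a, L.playProb G (hardLoss k S Δ b) a *
        ∑ t, (hardMean k S Δ β j (a t) - hardMean k S Δ β j c) := by
  have h : ∀ t, ∑ b, tilt β j univ b * ∑ a, L.playProb G (hardLoss k S Δ b) a *
      ((hardLoss k S Δ b t (a t) - hardLoss k S Δ b t c) -
        (hardMean k S Δ β j (a t) - hardMean k S Δ β j c)) = 0 := by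
    intro t
    have h1 := sum_tilt_mul_playProb_hardLoss_sub L G k S Δ β j t
    have h2 := sum_tilt_mul_playProb_hardLoss_sub_const L G k S Δ β j t c
    rw [← sub_zero (0 : ℝ)]
    nth_rewrite 1 [← h1]
    rw [← h2, ← sum_sub_distrib]
    refine sum_congr rfl fun b _ => ?_
    rw [← mul_sub, ← sum_sub_distrib]
    congr 1
    exact sum_congr rfl fun a _ => by ring
  rw [← sub_eq_zero, ← sum_eq_zero fun t (_ : t ∈ univ) => h t, sum_comm, ← sum_sub_distrib]
  refine sum_congr rfl fun b _ => ?_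
  rw [← mul_sub, ← mul_sum, Learner.gain, ← sum_sub_distrib, sum_comm]
  congr 1
  refine sum_congr rfl fun a _ => ?_
  rw [← mul_sub, ← sum_sub_distrib, mul_sum]

/-- The rounds in which the action `j` is observed. -/
def obsRounds (j : V) (a : Fin T → V) : Finset (Fin T) := univ.filter fun t => G.Adj (a t) j

/-- For a fixed action sequence the play probability ignores the unobserved signs of `j`, so their
likelihood factors sum out. -/
theorem sum_tilt_mul_playProb (β : ℝ) (j : V) (X : (Fin T → V) → ℝ) :
    ∑ b, tilt β j univ b * ∑ a, L.playProb G (hardLoss k S Δ b) a * X a =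
      ∑ b, ∑ a, tilt β j (obsRounds G j a) b * (L.playProb G (hardLoss k S Δ b) a * X a) := by
  simp_rw [mul_sum]
  rw [sum_comm, sum_comm (s := univ) (t := univ)
    (f := fun b a => tilt β j (obsRounds G j a) b * (L.playProb G (hardLoss k S Δ b) a * X a))]
  refine sum_congr rfl fun a _ => ?_
  have hu : (univ : Finset (Fin T)) = (univ.filter fun t => ¬ G.Adj (a t) j) ∪ obsRounds G j a := by
    ext t
    simp only [obsRounds, mem_union, mem_filter, mem_univ, true_and, true_iff]
    tauto
  rw [hu]
  refine sum_tilt_union β j _ _ ?_ _ fun t ht => ?_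
  · rw [disjoint_left]
    intro t h1 h2
    exact (mem_filter.1 h1).2 (mem_filter.1 h2).2
  · intro b v
    show L.playProb G _ a * X a = L.playProb G _ a * X a
    rw [playProb_congr L G a]
    intro s i hs
    refine hardLoss_update_of_ne _ _ _ _ _ _ _ _ fun h => ?_
    rw [Prod.mk.injEq] at h
    rw [h.1, h.2] at hs
    exact (mem_filter.1 ht).2 hs

/-- The observed signs of `j` form a martingale difference sequence. -/
theorem sum_playProb_mul_sq [Nonempty V] (j : V) :
    ∑ b, ∑ a, L.playProb G (hardLoss k S Δ b) a * (∑ t ∈ obsRounds G j a, sgn (b (t, j))) ^ 2 =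
      ∑ b, ∑ a, L.playProb G (hardLoss k S Δ b) a * (#(obsRounds G j a) : ℝ) := by
  set o : (Fin T → V) → Fin T → ℝ := fun a t => if G.Adj (a t) j then 1 else 0 with ho
  -- Cross terms vanish: the later sign is fresh given the earlier sign and all actions up to its
  -- own round.
  have hlt : ∀ s t, s < t → ∑ b, (sgn (b (s, j)) *
      ∑ a, L.playProb G (hardLoss k S Δ b) a * (o a s * o a t)) * sgn (b (t, j)) = 0 := by
    intro s t hst
    refine sum_mul_sgn (t, j) _ (IndepOf.mul (indepOf_comp sgn ?_)
      (indepOf_sum_playProb L G k S Δ t j _ fun r hr => IndepOf.mul ?_ ?_))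
    · simp [hst.ne]
    · exact indepOf_comp (fun x => if G.Adj x j then 1 else 0) (hst.trans hr).ne
    · exact indepOf_comp (fun x => if G.Adj x j then 1 else 0) hr.ne
  have hlt' : ∀ s t, s ≠ t → ∑ b, ∑ a, L.playProb G (hardLoss k S Δ b) a *
      ((o a s * sgn (b (s, j))) * (o a t * sgn (b (t, j)))) = 0 := by
    intro s t hst
    rcases lt_or_gt_of_ne hst with h | h
    · rw [← hlt s t h]
      refine sum_congr rfl fun b _ => ?_
      rw [mul_sum, sum_mul]
      exact sum_congr rfl fun a _ => by ring
    · rw [← hlt t s h]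
      refine sum_congr rfl fun b _ => ?_
      rw [mul_sum, sum_mul]
      exact sum_congr rfl fun a _ => by ring
  have hS : ∀ (a : Fin T → V) (b : Fin T × V → Bool), ∑ t ∈ obsRounds G j a, sgn (b (t, j)) = ∑ t, o a t * sgn (b (t, j)) := by
    intro a b
    simp [obsRounds, ho, sum_filter]
  have hA : ∀ a, (#(obsRounds G j a) : ℝ) = ∑ t, o a t := by
    intro a
    simp [obsRounds, ho]
  calc _ = ∑ s, ∑ t, ∑ b, ∑ a, L.playProb G (hardLoss k S Δ b) a *
      ((o a s * sgn (b (s, j))) * (o a t * sgn (b (t, j)))) := by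
        simp_rw [hS, sq, sum_mul_sum, mul_sum]
        rw [sum_congr rfl fun b _ => sum_comm, sum_comm]
        refine sum_congr rfl fun s _ => ?_
        rw [sum_congr rfl fun b _ => sum_comm, sum_comm]
    _ = ∑ s, ∑ b, ∑ a, L.playProb G (hardLoss k S Δ b) a *
      ((o a s * sgn (b (s, j))) * (o a s * sgn (b (s, j)))) := by
        refine sum_congr rfl fun s _ => ?_
        exact sum_eq_single s (fun t _ h => hlt' s t h.symm) (by simp)
    _ = _ := by
        simp_rw [hA, mul_sum]
        rw [sum_comm]
        refine sum_congr rfl fun b _ => ?_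
        rw [sum_comm]
        refine sum_congr rfl fun a _ => sum_congr rfl fun s _ => ?_
        have h1 := sgn_sq (b (s, j))
        have h2 : o a s * o a s = o a s := by simp [ho]
        linear_combination L.playProb G (hardLoss k S Δ b) a * (o a s * o a s) * h1
          + L.playProb G (hardLoss k S Δ b) a * h2

end Environment

/-! ### Expected play counts and the two regret bounds -/

section Counts

variable {V : Type*} [Fintype V] {T : ℕ} (L : Learner V T) (G : Digraph V)

/-- The expected number of rounds in which `i` is played in the hard environment with fair
signs. -/
def Learner.hardCount (k : V) (S : Finset V) (Δ : ℝ) (i : V) : ℝ :=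
  (Fintype.card (Fin T × V → Bool) : ℝ)⁻¹ *
    ∑ b, ∑ a, L.playProb G (hardLoss k S Δ b) a * ∑ t, if a t = i then 1 else 0

theorem sum_sum_playProb_mul (k : V) (S : Finset V) (Δ : ℝ) (g : V → ℝ) :
    ∑ b, ∑ a, L.playProb G (hardLoss k S Δ b) a * ∑ t, g (a t) =
      Fintype.card (Fin T × V → Bool) * ∑ i, g i * L.hardCount G k S Δ i := by
  have hZ : (Fintype.card (Fin T × V → Bool) : ℝ) ≠ 0 := by
    exact_mod_cast Fintype.card_ne_zero
  unfold Learner.hardCount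
  simp_rw [mul_left_comm (g _), ← mul_sum]
  rw [← mul_assoc, mul_inv_cancel₀ hZ, one_mul]
  simp_rw [mul_sum]
  rw [sum_comm (s := univ (α := V))]
  refine sum_congr rfl fun b _ => ?_
  rw [sum_comm (s := univ (α := V))]
  refine sum_congr rfl fun a _ => ?_
  rw [sum_comm (s := univ (α := V))]
  refine sum_congr rfl fun t _ => ?_
  simp [mul_comm]

theorem hardCount_nonneg (k : V) (S : Finset V) (Δ : ℝ) (i : V) :
    0 ≤ L.hardCount G k S Δ i := by
  refine mul_nonneg (by positivity) (sum_nonneg fun b _ => sum_nonneg fun a _ =>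
    mul_nonneg (playProb_nonneg _ _ _ _) (sum_nonneg fun t _ => ?_))
  split_ifs <;> norm_num

theorem sum_hardCount [Nonempty V] (k : V) (S : Finset V) (Δ : ℝ) :
    ∑ i, L.hardCount G k S Δ i = T := by
  have hZ : (Fintype.card (Fin T × V → Bool) : ℝ) ≠ 0 := by
    exact_mod_cast Fintype.card_ne_zero
  have h := sum_sum_playProb_mul L G k S Δ fun _ => 1
  simp only [← sum_mul, sum_playProb, one_mul, sum_const, nsmul_eq_mul, card_univ, mul_one,
    Fintype.card_fin] at h
  exact (mul_left_cancel₀ hZ h).symm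

variable {L G}

/-- The tilt is a nonnegative weight whose total is the number of bit patterns, so a bound on every
outcome passes to the weighted mean; there losses may be replaced by their means. -/
theorem sum_tilt_mul_le [Nonempty V] {M : ℝ}
    (hM : ∀ ℓ : Fin T → V → ℝ, (∀ t i, ℓ t i ∈ Set.Icc (0 : ℝ) 1) → ∀ c, L.gain G ℓ c ≤ M)
    {k : V} {S : Finset V} {Δ β : ℝ} (h0 : 0 ≤ Δ)
    (h1 : Δ ≤ 1 / 2) (hβ0 : 0 ≤ β) (hβ1 : β ≤ 1) (j c : V) (g : V → ℝ)
    (hg : ∀ i, g i ≤ hardMean k S Δ β j i - hardMean k S Δ β j c) :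
    ∑ b, tilt β j univ b * ∑ a, L.playProb G (hardLoss k S Δ b) a * ∑ t, g (a t) ≤
      Fintype.card (Fin T × V → Bool) * M := by
  rw [← sum_tilt (T := T) β j, sum_mul]
  refine le_trans ?_ (sum_le_sum fun b _ => mul_le_mul_of_nonneg_left
    (hM _ (hardLoss_mem h0 h1 k S b) c) (tilt_nonneg hβ0 hβ1 j univ b))
  rw [sum_tilt_mul_gain]
  exact sum_le_sum fun b _ => mul_le_mul_of_nonneg_left (sum_le_sum fun a _ =>
    mul_le_mul_of_nonneg_left (sum_le_sum fun t _ => hg _) (playProb_nonneg _ _ _ _))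
    (tilt_nonneg hβ0 hβ1 j univ b)

/-- The regret in the hard environment with fair signs is caused by exploration. -/
theorem hardCount_explore_le [Nonempty V] {M : ℝ}
    (hM : ∀ ℓ : Fin T → V → ℝ, (∀ t i, ℓ t i ∈ Set.Icc (0 : ℝ) 1) → ∀ c, L.gain G ℓ c ≤ M)
    {k : V} {S : Finset V} {Δ : ℝ} (h0 : 0 ≤ Δ)
    (h1 : Δ ≤ 1 / 2) :
    ∑ i, (if i = k then 0 else if i ∈ S then Δ / 4 else 1 / 2) * L.hardCount G k S Δ i ≤ M := by
  have hZ : 0 < (Fintype.card (Fin T × V → Bool) : ℝ) := by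
    exact_mod_cast Fintype.card_pos
  have h := sum_tilt_mul_le hM (k := k) (S := S) h0 h1 le_rfl zero_le_one k k
    (fun i => if i = k then 0 else if i ∈ S then Δ / 4 else 1 / 2) (fun i => by
      rw [show hardMean k S Δ 0 k k = 1 / 2 - Δ / 4 from if_pos rfl, hardMean]
      split_ifs <;> linarith)
  simp only [tilt, zero_mul, add_zero, prod_const_one, one_mul] at h
  rw [sum_sum_playProb_mul L G k S Δ
    fun i => if i = k then 0 else if i ∈ S then Δ / 4 else 1 / 2] at h
  exact le_of_mul_le_mul_left h hZ

/-- If `j` is rarely observed, the learner suffers when `j` is better than all other actions. -/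
theorem hardCount_confuse_le [Nonempty V] {M : ℝ}
    (hM : ∀ ℓ : Fin T → V → ℝ, (∀ t i, ℓ t i ∈ Set.Icc (0 : ℝ) 1) → ∀ c, L.gain G ℓ c ≤ M)
    {k : V} {S : Finset V} (hk : k ∉ S) {Δ : ℝ} (h0 : 0 ≤ Δ)
    (h1 : Δ ≤ 1 / 2) {j : V} (hj : j ∈ S) :
    Δ / 4 * (T - L.hardCount G k S Δ j -
      T * (1 / 8 + 3 * Δ ^ 2 * ∑ i, (if G.Adj i j then 1 else 0) * L.hardCount G k S Δ i)) ≤ M := by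
  have hZ : 0 < (Fintype.card (Fin T × V → Bool) : ℝ) := by
    exact_mod_cast Fintype.card_pos
  have hjk : j ≠ k := fun h => hk (h ▸ hj)
  have h := sum_tilt_mul_le hM (k := k) (S := S) h0 h1 h0 (by linarith) j j
    -- The tilted `j` has mean `1/2 - Δ/2`; the closest competitor is `k`, at distance `Δ/4`.
    (fun i => Δ / 4 * if i = j then 0 else 1) (fun i => by
      unfold hardMean
      rw [if_neg hjk, if_pos hj, if_pos rfl]
      split_ifs <;> first | (subst_vars; contradiction) | linarith)
  simp_rw [← mul_sum, mul_left_comm _ (Δ / 4), ← mul_sum, mul_left_comm _ (Δ / 4), ← mul_sum] at h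
  rw [sum_tilt_mul_playProb] at h
  refine le_of_mul_le_mul_left (le_trans ?_ h) hZ
  rw [mul_left_comm]
  refine mul_le_mul_of_nonneg_left ?_ (by linarith)
  have hpt : ∀ (b : Fin T × V → Bool) (a : Fin T → V), L.playProb G (hardLoss k S Δ b) a *
      ((∑ t, if a t = j then 0 else 1) - T * (1 / 8 + 2 * Δ ^ 2 *
        (∑ t ∈ obsRounds G j a, sgn (b (t, j))) ^ 2 + Δ ^ 2 * #(obsRounds G j a))) ≤
      tilt Δ j (obsRounds G j a) b * (L.playProb G (hardLoss k S Δ b) a *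
        ∑ t, if a t = j then 0 else 1) := by
    intro b a
    rw [mul_left_comm]
    refine mul_le_mul_of_nonneg_left (sub_le_tilt_mul h0 h1 _ _ _ ?_ ?_) (playProb_nonneg _ _ _ _)
    · exact sum_nonneg fun t _ => by split_ifs <;> norm_num
    · calc ∑ t, (if a t = j then (0 : ℝ) else 1) ≤ ∑ t : Fin T, 1 :=
            sum_le_sum fun t _ => by split_ifs <;> norm_num
        _ = T := by simp
  refine le_trans (le_of_eq ?_) (sum_le_sum fun b _ => sum_le_sum fun a _ => hpt b a)
  have e1 : ∀ a : Fin T → V, (∑ t, if a t = j then (0 : ℝ) else 1) =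
      T - ∑ t, if a t = j then 1 else 0 := by
    intro a
    rw [eq_sub_iff_add_eq, ← sum_add_distrib]
    trans ∑ t : Fin T, (1 : ℝ)
    · exact sum_congr rfl fun t _ => by split_ifs <;> norm_num
    · simp
  have e2 := sum_playProb_mul_sq L G k S Δ j
  have e3 := sum_sum_playProb_mul L G k S Δ fun i => if G.Adj i j then 1 else 0
  have e4 := sum_sum_playProb_mul L G k S Δ fun i => if i = j then 1 else 0
  have e5 : ∑ b, ∑ a, L.playProb G (hardLoss k S Δ b) a = Fintype.card (Fin T × V → Bool) := by
    simp [sum_playProb]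
  have e6 : ∀ a : Fin T → V, (∑ t, if G.Adj (a t) j then (1 : ℝ) else 0) =
      #(obsRounds G j a) := fun a => by simp [obsRounds]
  simp_rw [e6] at e3
  rw [e3] at e2
  simp only [ite_mul, one_mul, zero_mul, sum_ite_eq', mem_univ, if_true] at e4
  have hexp : ∀ (b : Fin T × V → Bool) (a : Fin T → V), L.playProb G (hardLoss k S Δ b) a *
      ((∑ t, if a t = j then 0 else 1) - T * (1 / 8 + 2 * Δ ^ 2 *
        (∑ t ∈ obsRounds G j a, sgn (b (t, j))) ^ 2 + Δ ^ 2 * #(obsRounds G j a))) =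
      (T - T / 8) * L.playProb G (hardLoss k S Δ b) a
      - L.playProb G (hardLoss k S Δ b) a * (∑ t, if a t = j then 1 else 0)
      - 2 * T * Δ ^ 2 * (L.playProb G (hardLoss k S Δ b) a *
        (∑ t ∈ obsRounds G j a, sgn (b (t, j))) ^ 2)
      - T * Δ ^ 2 * (L.playProb G (hardLoss k S Δ b) a * #(obsRounds G j a)) := by
    intro b a
    rw [e1]
    ring
  simp_rw [hexp, sum_sub_distrib, ← mul_sum, e2, e3, e4, e5]
  ring

end Counts

/-! ### Elementary bounds on `Q*` -/

section ComplexityQ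

variable {V : Type*} [Fintype V] (G : Digraph V) (T : ℕ) (I : Finset V) {Δ : ℝ}

theorem objective_nonneg (h0 : 0 ≤ Δ) {π : V → ℝ} (hπ : ∀ i, 0 ≤ π i) :
    0 ≤ min ((T : ℝ) * ∑ i ∈ I, π i * Δ + (T : ℝ) * ∑ i ∈ Iᶜ, π i) ((T : ℝ) * Δ) := by
  refine le_min (add_nonneg (mul_nonneg (by positivity) ?_) (mul_nonneg (by positivity) ?_))
    (by positivity)
  · exact sum_nonneg fun i _ => mul_nonneg (hπ i) h0
  · exact sum_nonneg fun i _ => hπ i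

theorem complexityQAt_nonneg (h0 : 0 ≤ Δ) : 0 ≤ complexityQAt G T I Δ := by
  unfold complexityQAt
  split_ifs
  · refine Real.sInf_nonneg ?_
    rintro _ ⟨π, hπ, rfl⟩
    exact objective_nonneg T I h0 hπ.1
  · positivity

theorem complexityQAt_le_objective (h0 : 0 ≤ Δ) {π : V → ℝ} (hπ : π ∈ feasible G T I Δ) :
    complexityQAt G T I Δ ≤
      min ((T : ℝ) * ∑ i ∈ I, π i * Δ + (T : ℝ) * ∑ i ∈ Iᶜ, π i) ((T : ℝ) * Δ) := by
  unfold complexityQAt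
  rw [if_pos ⟨π, hπ⟩]
  refine csInf_le ⟨0, ?_⟩ ⟨π, hπ, rfl⟩
  rintro _ ⟨π', hπ', rfl⟩
  exact objective_nonneg T I h0 hπ'.1

theorem complexityQAt_le (h0 : 0 ≤ Δ) : complexityQAt G T I Δ ≤ T * Δ := by
  by_cases h : (feasible G T I Δ).Nonempty
  · obtain ⟨π, hπ⟩ := h
    exact (complexityQAt_le_objective G T I h0 hπ).trans (min_le_right _ _)
  · exact (if_neg h).le

theorem bddAbove_complexityQAt : BddAbove (complexityQAt G T I '' Set.Ioc 0 (1 / 2)) := by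
  refine ⟨T * (1 / 2), ?_⟩
  rintro _ ⟨Δ, hΔ, rfl⟩
  exact (complexityQAt_le G T I hΔ.1.le).trans (mul_le_mul_of_nonneg_left hΔ.2 (by positivity))

theorem complexityQAt_le_complexityQ (h0 : 0 < Δ) (h1 : Δ ≤ 1 / 2) :
    complexityQAt G T I Δ ≤ complexityQ G T :=
  (le_csSup (bddAbove_complexityQAt G T I) ⟨Δ, ⟨h0, h1⟩, rfl⟩).trans
    (le_ciSup (f := complexityQOn G T) (Set.finite_range _).bddAbove I)

theorem complexityQ_nonneg : 0 ≤ complexityQ G T :=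
  (complexityQAt_nonneg G T ∅ (by norm_num : (0 : ℝ) ≤ 1 / 2)).trans
    (complexityQAt_le_complexityQ G T ∅ (by norm_num) le_rfl)

theorem complexityQ_le {x : ℝ}
    (h : ∀ I Δ, 0 < Δ → Δ ≤ 1 / 2 → complexityQAt G T I Δ ≤ x) : complexityQ G T ≤ x := by
  refine ciSup_le fun I => csSup_le ⟨_, 1 / 2, by norm_num, rfl⟩ ?_
  rintro _ ⟨Δ, hΔ, rfl⟩
  exact h I Δ hΔ.1 hΔ.2

end ComplexityQ

/-! ### The regret lower bound -/

section LowerBound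

variable {V : Type*} [Fintype V] {T : ℕ} {L : Learner V T} {G : Digraph V} {M : ℝ}

/-- Two actions suffice for a regret of order `√T`, even with full information. -/
theorem sqrt_le_of_gain_le
    (hM : ∀ ℓ : Fin T → V → ℝ, (∀ t i, ℓ t i ∈ Set.Icc (0 : ℝ) 1) → ∀ c, L.gain G ℓ c ≤ M)
    (hN : 2 ≤ Fintype.card V) (hT : 0 < T) : √T ≤ 50 * M := by
  obtain ⟨k, j, hkj⟩ := Fintype.exists_pair_of_one_lt_card hN
  have : Nonempty V := ⟨k⟩
  have hT1 : (1 : ℝ) ≤ T := by exact_mod_cast hT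
  set r := √(T : ℝ) with hr
  have hr1 : 1 ≤ r := Real.one_le_sqrt.2 hT1
  have hrr : r * r = T := Real.mul_self_sqrt (by positivity)
  -- At this scale even observing `j` in all `T` rounds contributes only `3 * Δ ^ 2 * T = 3 / 16` to
  -- the confusion bound.
  have hΔ0 : 0 ≤ 1 / (4 * r) := by positivity
  have hΔ1 : 1 / (4 * r) ≤ 1 / 2 := by
    rw [div_le_div_iff₀ (by positivity) (by positivity)]
    linarith
  have hk : k ∉ ({j} : Finset V) := by simpa using hkj
  have h1 := hardCount_explore_le hM (k := k) (S := {j}) hΔ0 hΔ1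
  have h2 := hardCount_confuse_le hM hk hΔ0 hΔ1 (mem_singleton_self j)
  set n := L.hardCount G k {j} (1 / (4 * r)) with hn
  have hn0 : ∀ i, 0 ≤ n i := hardCount_nonneg L G k {j} _
  have h3 : 1 / (4 * r) / 4 * n j ≤ M := by
    refine le_trans ?_ h1
    refine le_trans (le_of_eq ?_) (single_le_sum (fun i _ => mul_nonneg ?_ (hn0 i)) (mem_univ j))
    · simp [hkj.symm]
    · split_ifs <;> positivity
  have h4 : ∑ i, (if G.Adj i j then 1 else 0) * n i ≤ r * r := by
    rw [hrr, ← sum_hardCount L G k {j} (1 / (4 * r))]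
    refine sum_le_sum fun i _ => ?_
    split_ifs
    · rw [one_mul]
    · rw [zero_mul]
      exact hn0 i
  have h5 : 3 * (1 / (4 * r)) ^ 2 * ∑ i, (if G.Adj i j then 1 else 0) * n i ≤ 3 / 16 := by
    refine (mul_le_mul_of_nonneg_left h4 (by positivity)).trans (le_of_eq ?_)
    field_simp
    norm_num
  have h6 : 1 / (4 * r) / 4 * (T - n j - T * (1 / 8 + 3 / 16)) ≤ M := by
    refine le_trans (mul_le_mul_of_nonneg_left ?_ (by positivity)) h2
    nlinarith
  have h7 : 1 / (4 * r) / 4 * (T - T * (1 / 8 + 3 / 16)) = 11 / 256 * r := by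
    rw [← hrr]
    field_simp
    norm_num
  nlinarith

theorem complexityQAt_le_of_gain_le (hloop : ∀ v, G.Adj v v)
    (hM : ∀ ℓ : Fin T → V → ℝ, (∀ t i, ℓ t i ∈ Set.Icc (0 : ℝ) 1) → ∀ c, L.gain G ℓ c ≤ M)
    (hN : 2 ≤ Fintype.card V) (I : Finset V) {Δ : ℝ} (h0 : 0 < Δ) (h1 : Δ ≤ 1 / 2) :
    complexityQAt G T I Δ ≤ 100 * M := by
  have hne : Nonempty V := Fintype.card_pos_iff.1 (by omega)
  have hM0 : 0 ≤ M := by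
    simpa [Learner.gain] using hM (fun _ _ => 0) (by simp) (Classical.arbitrary V)
  by_contra! hlt
  have hQT := complexityQAt_le G T I h0.le
  set Q := complexityQAt G T I Δ with hQ
  have hQ0 : 0 < Q := by linarith
  have hTΔ : 0 < (T : ℝ) * Δ := by linarith
  have hT0 : (0 : ℝ) < T := pos_of_mul_pos_left hTΔ h0.le
  have hT : 0 < T := by exact_mod_cast hT0
  -- Otherwise `Q ^ 2 ≤ Q * (T * Δ) ≤ 3 * T`, and the two-action bound already gives `Q ≤ 100 * M`.
  have hQΔ : 3 < Q * Δ := by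
    by_contra! h
    have hs := sqrt_le_of_gain_le hM hN hT
    have hss : √(T : ℝ) * √(T : ℝ) = T := Real.mul_self_sqrt hT0.le
    have h2 : Q * Q ≤ 3 * T := by
      calc Q * Q ≤ Q * (T * Δ) := mul_le_mul_of_nonneg_left hQT hQ0.le
        _ = (Q * Δ) * T := by ring
        _ ≤ 3 * T := by gcongr
    have : Q ≤ 2 * √(T : ℝ) := by
      refine le_of_sq_le_sq ?_ (by positivity)
      nlinarith
    linarith
  have hTΔ2 : 3 < T * Δ ^ 2 := by nlinarith
  obtain ⟨k, hkI⟩ : I.Nonempty := by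
    rw [nonempty_iff_ne_empty]
    rintro rfl
    have := complexityQAt_le_objective G T ∅ h0.le (π := fun _ => 0) (by simp [feasible])
    have := this.trans (min_le_left _ _)
    simp at this
    linarith
  -- Playing `k` would reveal its out-neighbours for free, so these are left out of the random
  -- actions.
  set S := I.filter fun j => ¬ G.Adj k j with hS
  have hkS : k ∉ S := by simp [hS, hloop]
  have hexp := hardCount_explore_le hM (k := k) (S := S) h0.le h1
  have hn0 : ∀ i, 0 ≤ L.hardCount G k S Δ i := hardCount_nonneg L G k S Δ
  have hconf := fun j (hj : j ∈ S) => hardCount_confuse_le hM hkS h0.le h1 hj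
  set N := L.hardCount G k S Δ
  have hex : ∃ j ∈ S, ∑ i, (if G.Adj i j then 1 else 0) * N i < 1 / (16 * Δ ^ 2) := by
    by_contra! hall
    set n : V → ℝ := fun i => if i = k then 0 else N i with hn
    have hnn : ∀ i, 0 ≤ n i := fun i => by
      simp only [hn]
      split_ifs
      exacts [le_rfl, hn0 i]
    have hnsum : ∀ g : V → ℝ, (∀ i, g i ≤ if i ∈ S then Δ else 2) → ∑ i, g i * n i ≤ 4 * M := by
      intro g hg
      refine le_trans ?_ (mul_le_mul_of_nonneg_left hexp (by norm_num))
      rw [mul_sum]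
      refine sum_le_sum fun i _ => ?_
      have := hg i
      have := hn0 i
      simp only [hn]
      split_ifs at * <;> nlinarith
    -- The mass on `k` covers the out-neighbours of `k` in `I`; the factor `16` makes the
    -- exploration counts cover `S`. The objective is at most `1/Δ + 64 * M < Q/3 + 64 * M`,
    -- contradicting `Q > 100 * M`.
    set p : V → ℝ := fun i => (if i = k then 1 / (T * Δ ^ 2) else 0) + 16 / T * n i with hp
    have hpsum : ∀ g : V → ℝ, ∑ i, p i * g i = 1 / (T * Δ ^ 2) * g k + 16 / T * ∑ i, g i * n i := by
      intro g
      simp only [hp, add_mul, sum_add_distrib, ite_mul, zero_mul, sum_ite_eq', mem_univ, if_true,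
        mul_sum]
      congr 1
      exact sum_congr rfl fun i _ => by ring
    have hfeas : p ∈ feasible G T I Δ := by
      refine ⟨fun i => ?_, ?_, fun j hj => ?_⟩
      · refine add_nonneg ?_ (mul_nonneg (by positivity) (hnn i))
        split_ifs <;> positivity
      · have e1 := hpsum fun _ => 1
        simp only [mul_one] at e1
        rw [e1]
        have e2 := hnsum (fun _ => Δ) fun i => by split_ifs <;> linarith
        rw [← mul_sum] at e2
        simp only [one_mul]
        have e3 : 1 / (T * Δ ^ 2) ≤ 1 / 3 := one_div_le_one_div_of_le (by norm_num) hTΔ2.le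
        have e4 : 16 / T * ∑ i, n i ≤ 64 / 100 := by
          rw [div_mul_eq_mul_div, div_le_div_iff₀ hT0 (by norm_num)]
          refine le_of_mul_le_mul_left ?_ h0
          nlinarith
        linarith
      · rw [hpsum, mul_add]
        by_cases hkj : G.Adj k j
        · have e1 : 0 ≤ (T : ℝ) * (16 / T * ∑ i, (if G.Adj i j then 1 else 0) * n i) := by
            refine mul_nonneg hT0.le (mul_nonneg (by positivity) (sum_nonneg fun i _ =>
              mul_nonneg ?_ (hnn i)))
            split_ifs <;> norm_num
          have e2 : (T : ℝ) * (1 / (T * Δ ^ 2) * if G.Adj k j then 1 else 0) = 1 / Δ ^ 2 := by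
            rw [if_pos hkj]
            field_simp
          linarith
        · have e1 := hall j (mem_filter.2 ⟨hj, hkj⟩)
          have e2 : ∑ i, (if G.Adj i j then 1 else 0) * n i =
              ∑ i, (if G.Adj i j then 1 else 0) * N i := by
            refine sum_congr rfl fun i _ => ?_
            simp only [hn]
            split_ifs with a1 a2 <;> first | rfl | (subst_vars; contradiction) | simp
          rw [if_neg hkj, e2, ← mul_assoc, ← mul_assoc (T : ℝ), mul_div_cancel₀ _ hT0.ne']
          have e3 : 1 / Δ ^ 2 = 16 * (1 / (16 * Δ ^ 2)) := by field_simp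
          linarith
    have hobj := (complexityQAt_le_objective G T I h0.le hfeas).trans (min_le_left _ _)
    have e1 : (T : ℝ) * ∑ i ∈ I, p i * Δ + T * ∑ i ∈ Iᶜ, p i =
        T * ∑ i, p i * if i ∈ I then Δ else 1 := by
      rw [← mul_add, ← sum_add_sum_compl I]
      congr 2
      · exact sum_congr rfl fun i hi => by rw [if_pos hi]
      · exact sum_congr rfl fun i hi => by rw [if_neg (mem_compl.1 hi), mul_one]
    rw [e1, hpsum, if_pos hkI] at hobj
    have e2 := hnsum (fun i => if i ∈ I then Δ else 1) fun i => by
      have : i ∈ S → i ∈ I := fun h => (mem_filter.1 h).1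
      split_ifs <;> first | (exfalso; tauto) | linarith
    have e3 : (T : ℝ) * (1 / (T * Δ ^ 2) * Δ + 16 / T * ∑ i, (if i ∈ I then Δ else 1) * n i) =
        1 / Δ + 16 * ∑ i, (if i ∈ I then Δ else 1) * n i := by
      field_simp
    have e4 : 1 / Δ < Q / 3 := by
      rw [div_lt_div_iff₀ h0 (by norm_num)]
      linarith
    linarith
  obtain ⟨j, hj, hjobs⟩ := hex
  have h2 := hconf j hj
  set s := ∑ i, (if G.Adj i j then 1 else 0) * N i with hs
  have h3 : N j ≤ s := by
    refine le_trans (le_of_eq ?_) (single_le_sum (fun i _ => mul_nonneg ?_ (hn0 i)) (mem_univ j))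
    · simp [hloop]
    · split_ifs <;> norm_num
  rw [lt_div_iff₀ (by positivity)] at hjobs
  have h4 : s ≤ T / 48 := by
    have hs0 : 0 ≤ s := (hn0 j).trans h3
    have : 0 < Δ ^ 2 := by positivity
    by_contra! h
    nlinarith
  -- The left side is `T * Δ / 6`, whereas `T * Δ ≥ Q > 100 * M`.
  have h5 : Δ / 4 * (T - T / 48 - T * (1 / 8 + 3 / 16)) ≤ M := by
    refine le_trans (mul_le_mul_of_nonneg_left ?_ (by positivity)) h2
    have : (T : ℝ) * (1 / 8 + 3 * Δ ^ 2 * s) ≤ T * (1 / 8 + 3 / 16) :=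
      mul_le_mul_of_nonneg_left (by linarith) hT0.le
    linarith
  nlinarith

/-- As only the maximal expected regret over all actions matters, a deterministic loss sequence
suffices: the average regret in the hard environment is attained by one of its outcomes. -/
theorem exists_le_gain (hloop : ∀ v, G.Adj v v) (hN : 2 ≤ Fintype.card V) (L : Learner V T) :
    ∃ ℓ : Fin T → V → ℝ, (∀ t i, ℓ t i ∈ Set.Icc (0 : ℝ) 1) ∧
      ∃ c, complexityQ G T / 2 ^ 7 ≤ L.gain G ℓ c := by
  by_contra! h
  have hne : Nonempty V := Fintype.card_pos_iff.1 (by omega)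
  have h0 : 0 < complexityQ G T / 2 ^ 7 := by
    simpa [Learner.gain] using h (fun _ _ => 0) (by simp) (Classical.arbitrary V)
  -- The constant `100 < 2 ^ 7` makes this contradict the positivity of `Q*`.
  have := complexityQ_le G T fun I Δ hΔ0 hΔ1 =>
    complexityQAt_le_of_gain_le (M := complexityQ G T / 2 ^ 7) hloop
      (fun ℓ hℓ c => (h ℓ hℓ c).le) hN I hΔ0 hΔ1
  linarith

theorem exists_le_regret (hloop : ∀ v, G.Adj v v) (hN : 2 ≤ Fintype.card V) (L : Learner V T) :
    ∃ μ : MeasureTheory.Measure (Fin T → V → ℝ),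
      MeasureTheory.IsProbabilityMeasure μ ∧
      (∀ᵐ ℓ ∂μ, ∀ t i, ℓ t i ∈ Set.Icc (0 : ℝ) 1) ∧
      complexityQ G T / 2 ^ 7 ≤ L.regret G μ := by
  obtain ⟨ℓ, hℓ, c, hc⟩ := exists_le_gain hloop hN L
  refine ⟨MeasureTheory.Measure.dirac ℓ, inferInstance, ?_, hc.trans ?_⟩
  · rw [MeasureTheory.ae_dirac_eq]
    exact hℓ
  · unfold Learner.regret
    simp_rw [MeasureTheory.integral_dirac]
    exact le_ciSup (f := L.gain G ℓ) (Set.finite_range _).bddAbove c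

end LowerBound

/-! ### Fractional and integral set cover -/

section Cover

variable {V : Type*} (G : Digraph V)

/-- The greedy algorithm for set cover. -/
theorem exists_greedy_cover (A B : Finset V) (y : V → ℝ) (hy : ∀ i, 0 ≤ y i)
    (hf : 0 < ∑ i ∈ A, y i) (hcov : ∀ j ∈ B, 1 ≤ ∑ i ∈ A, y i * if G.Adj i j then 1 else 0)
    (m : ℕ) : ∃ D ⊆ A, #D ≤ m ∧
      (#(B.filter fun j => ¬ ∃ i ∈ D, G.Adj i j) : ℝ) ≤ #B * (1 - 1 / ∑ i ∈ A, y i) ^ m := by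
  set f := ∑ i ∈ A, y i with hfdef
  rcases B.eq_empty_or_nonempty with rfl | ⟨j₀, hj₀⟩
  · exact ⟨∅, by simp, by simp, by simp⟩
  have hf1 : 1 ≤ f := (hcov j₀ hj₀).trans (sum_le_sum fun i _ => by
    have := hy i
    split_ifs <;> linarith)
  have hfac : 0 ≤ 1 - 1 / f := by
    rw [sub_nonneg, div_le_one hf]
    exact hf1
  induction m with
  | zero =>
    refine ⟨∅, by simp, by simp, ?_⟩
    simp
  | succ m ih =>
    obtain ⟨D, hDA, hDm, hD⟩ := ih
    set U := B.filter fun j => ¬ ∃ i ∈ D, G.Adj i j with hU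
    have hsum : ∑ i ∈ A, y i * (#U / f) ≤ ∑ i ∈ A, y i * #(U.filter fun j => G.Adj i j) := by
      rw [← sum_mul, ← hfdef, mul_div_cancel₀ _ hf.ne']
      calc (#U : ℝ) = ∑ j ∈ U, 1 := by simp
        _ ≤ ∑ j ∈ U, ∑ i ∈ A, y i * if G.Adj i j then 1 else 0 :=
            sum_le_sum fun j hj => hcov j (mem_filter.1 hj).1
        _ = ∑ i ∈ A, y i * #(U.filter fun j => G.Adj i j) := by
            rw [sum_comm]
            refine sum_congr rfl fun i _ => ?_
            rw [← mul_sum]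
            simp
    -- By averaging with weights `y`, some action covers at least a fraction `1 / f` of what is
    -- left.
    obtain ⟨i, hiA, hi⟩ : ∃ i ∈ A, (#U : ℝ) / f ≤ #(U.filter fun j => G.Adj i j) := by
      by_contra! hall
      obtain ⟨i, hiA, hi0⟩ : ∃ i ∈ A, 0 < y i := by
        by_contra! h
        exact absurd (sum_nonpos h) (not_le.2 hf)
      exact absurd hsum (not_le.2 (sum_lt_sum
        (fun i hi => mul_le_mul_of_nonneg_left (hall i hi).le (hy i))
        ⟨i, hiA, mul_lt_mul_of_pos_left (hall i hiA) hi0⟩))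
    refine ⟨insert i D, insert_subset hiA hDA, (card_insert_le _ _).trans (by omega), ?_⟩
    have hsplit : (B.filter fun j => ¬ ∃ i' ∈ insert i D, G.Adj i' j) =
        U.filter fun j => ¬ G.Adj i j := by
      ext j
      simp only [hU, mem_filter, mem_insert, exists_eq_or_imp, not_or]
      tauto
    have hcard := card_filter_add_card_filter_not (s := U) fun j => G.Adj i j
    have hcard' : (#(U.filter fun j => G.Adj i j) : ℝ) + #(U.filter fun j => ¬ G.Adj i j) = #U := by
      exact_mod_cast hcard
    rw [hsplit, pow_succ, ← mul_assoc]
    refine le_trans ?_ (mul_le_mul_of_nonneg_right hD hfac)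
    rw [mul_sub, mul_one, mul_one_div]
    linarith

variable [Fintype V]

/-- The integrality gap of set cover is at most logarithmic. -/
theorem exists_dominates_card_le (A B : Finset V) (y : V → ℝ) (hy : ∀ i, 0 ≤ y i)
    (hcov : ∀ j ∈ B, 1 ≤ ∑ i ∈ A, y i * if G.Adj i j then 1 else 0) :
    ∃ D, Dominates G A B D ∧ (#D : ℝ) ≤ (∑ i ∈ A, y i) * (1 + Real.log (Fintype.card V)) := by
  have hlog : 0 ≤ Real.log (Fintype.card V) := Real.log_natCast_nonneg _
  rcases B.eq_empty_or_nonempty with rfl | ⟨j₀, hj₀⟩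
  · refine ⟨∅, ⟨by simp, by simp⟩, ?_⟩
    have := sum_nonneg fun i (_ : i ∈ A) => hy i
    simp only [card_empty, Nat.cast_zero]
    positivity
  have hf1 : 1 ≤ ∑ i ∈ A, y i := (hcov j₀ hj₀).trans (sum_le_sum fun i _ => by
    have := hy i
    split_ifs <;> linarith)
  have hf : 0 < ∑ i ∈ A, y i := by linarith
  -- Strictly more than `f * log N` steps leave fewer than `N * (1 / N) = 1` uncovered actions.
  set m := ⌊(∑ i ∈ A, y i) * Real.log (Fintype.card V)⌋₊ + 1 with hm
  obtain ⟨D, hDA, hDm, hD⟩ := exists_greedy_cover G A B y hy hf hcov m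
  set f := ∑ i ∈ A, y i
  have hmlt : f * Real.log (Fintype.card V) < m := by
    rw [hm]
    exact_mod_cast Nat.lt_floor_add_one (f * Real.log (Fintype.card V))
  have hmle : (m : ℝ) ≤ f * Real.log (Fintype.card V) + 1 := by
    rw [hm, Nat.cast_add, Nat.cast_one]
    have := Nat.floor_le (mul_nonneg hf.le hlog)
    linarith
  have hVpos : (0 : ℝ) < Fintype.card V := by
    exact_mod_cast Fintype.card_pos_iff.2 ⟨j₀⟩
  have hpow : (1 - 1 / f) ^ m < (Fintype.card V : ℝ)⁻¹ := by
    calc (1 - 1 / f) ^ m ≤ Real.exp (-(1 / f)) ^ m := by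
          refine pow_le_pow_left₀ ?_ (Real.one_sub_le_exp_neg _) m
          rw [sub_nonneg, div_le_one hf]
          exact hf1
      _ = Real.exp (-(m / f)) := by
          rw [← Real.exp_nat_mul]
          congr 1
          ring
      _ < Real.exp (-Real.log (Fintype.card V)) := by
          rw [Real.exp_lt_exp, neg_lt_neg_iff, lt_div_iff₀ hf]
          linarith
      _ = _ := by rw [Real.exp_neg, Real.exp_log hVpos]
  have hlt : (#(B.filter fun j => ¬ ∃ i ∈ D, G.Adj i j) : ℝ) < 1 := by
    refine hD.trans_lt ?_
    have h1 : (#B : ℝ) ≤ Fintype.card V := by exact_mod_cast card_le_univ B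
    have h2 : (0 : ℝ) < #B := by exact_mod_cast card_pos.2 ⟨j₀, hj₀⟩
    calc (#B : ℝ) * (1 - 1 / f) ^ m < #B * (Fintype.card V : ℝ)⁻¹ :=
          mul_lt_mul_of_pos_left hpow h2
      _ ≤ Fintype.card V * (Fintype.card V : ℝ)⁻¹ := by gcongr
      _ = 1 := mul_inv_cancel₀ hVpos.ne'
  have hzero : B.filter (fun j => ¬ ∃ i ∈ D, G.Adj i j) = ∅ := by
    rw [← card_eq_zero]
    have : #(B.filter fun j => ¬ ∃ i ∈ D, G.Adj i j) < 1 := by exact_mod_cast hlt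
    omega
  refine ⟨D, ⟨hDA, fun j hj => ?_⟩, ?_⟩
  · by_contra h
    exact notMem_empty j (hzero ▸ mem_filter.2 ⟨hj, h⟩)
  · have : (#D : ℝ) ≤ m := by exact_mod_cast hDm
    linarith

end Cover

/-! ### Comparison of `Q*` with `R*` -/

section Compare

theorem rpow_mul_rpow_le_ofReal {d : ℝ≥0∞} {m T p : ℕ} (hp : p ≠ 0) {x : ℝ} (hx : 0 ≤ x) (e : ℕ)
    (hd : d ≤ m) (h : (m : ℝ) * T ^ e ≤ x ^ p) :
    d ^ (1 / p : ℝ) * (T : ℝ≥0∞) ^ (e / p : ℝ) ≤ ENNReal.ofReal x := by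
  have hp0 : (0 : ℝ) ≤ 1 / p := by positivity
  have h1 : (T : ℝ≥0∞) ^ (e / p : ℝ) = ((T : ℝ≥0∞) ^ e) ^ (1 / p : ℝ) := by
    rw [← ENNReal.rpow_natCast, ← ENNReal.rpow_mul, mul_one_div]
  rw [h1, ← ENNReal.mul_rpow_of_nonneg _ _ hp0]
  have h2 : d * (T : ℝ≥0∞) ^ e ≤ ENNReal.ofReal (x ^ p) := by
    refine (mul_le_mul_left hd _).trans ?_
    have := ENNReal.ofReal_le_ofReal h
    rwa [ENNReal.ofReal_mul (by positivity), ENNReal.ofReal_pow (by positivity),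
      ENNReal.ofReal_natCast, ENNReal.ofReal_natCast] at this
  refine (ENNReal.rpow_le_rpow h2 hp0).trans (le_of_eq ?_)
  rw [ENNReal.ofReal_pow hx, ← ENNReal.rpow_natCast, ← ENNReal.rpow_mul,
    mul_one_div_cancel (by exact_mod_cast hp), ENNReal.rpow_one]

variable {V : Type*} (G : Digraph V) {T : ℕ}

theorem dominatingNumber_le {A B D : Finset V} (h : Dominates G A B D) :
    (dominatingNumber G A B : ℝ≥0∞) ≤ #D := by
  have h1 : dominatingNumber G A B ≤ (#D : ℕ∞) := iInf₂_le D h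
  have h2 := ENat.toENNReal_le.2 h1
  simpa using h2

variable [Fintype V]

/-- At `Δ = 1 / (2 * T)` a single action would need `4 * T ^ 2 > T` observations, so the default
value `T * Δ = 1 / 2` applies. -/
theorem half_le_complexityQ [Nonempty V] (hT : 0 < T) : 1 / 2 ≤ complexityQ G T := by
  have hT1 : (1 : ℝ) ≤ T := by exact_mod_cast hT
  have h0 : 0 < 1 / (2 * (T : ℝ)) := by positivity
  have h1 : 1 / (2 * (T : ℝ)) ≤ 1 / 2 := by
    rw [div_le_div_iff₀ (by positivity) (by norm_num)]
    linarith
  set v := Classical.arbitrary V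
  refine le_trans (le_of_eq ?_) (complexityQAt_le_complexityQ G T {v} h0 h1)
  unfold complexityQAt
  rw [if_neg]
  · field_simp
  · rintro ⟨π, hπ0, hπ1, hπ⟩
    have h2 := hπ v (by simp)
    have h3 : ∑ i, π i * (if G.Adj i v then 1 else 0) ≤ 1 := by
      refine (sum_le_sum fun i _ => ?_).trans hπ1
      have := hπ0 i
      split_ifs <;> linarith
    have h4 : 1 / (1 / (2 * (T : ℝ))) ^ 2 = 4 * T ^ 2 := by
      field_simp
      norm_num
    rw [h4] at h2
    nlinarith

theorem exists_feasible_lt {I : Finset V} {Δ : ℝ} (h : complexityQAt G T I Δ < T * Δ) :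
    ∃ π ∈ feasible G T I Δ, (T : ℝ) * ∑ i ∈ I, π i * Δ + T * ∑ i ∈ Iᶜ, π i < T * Δ := by
  unfold complexityQAt at h
  split_ifs at h with hne
  · obtain ⟨_, ⟨π, hπ, rfl⟩, hlt⟩ := exists_lt_of_csInf_lt (hne.image _) h
    exact ⟨π, hπ, (min_lt_iff.1 hlt).resolve_right (lt_irrefl _)⟩
  · exact absurd h (lt_irrefl _)

theorem exists_dominates_of_feasible {I : Finset V} {Δ : ℝ} (h0 : 0 < Δ) {π : V → ℝ}
    (hπ : π ∈ feasible G T I Δ)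
    (hlt : (T : ℝ) * ∑ i ∈ I, π i * Δ + T * ∑ i ∈ Iᶜ, π i < T * Δ) :
    ∃ J ⊆ I, ∃ D₁ D₂, Dominates G I J D₁ ∧ Dominates G univ (I \ J) D₂ ∧
      (#D₁ : ℝ) ≤ 2 * T * Δ ^ 2 * (1 + Real.log (Fintype.card V)) ∧
      (#D₂ : ℝ) ≤ 2 * T * Δ ^ 3 * (1 + Real.log (Fintype.card V)) := by
  obtain ⟨hπ0, -, hcov⟩ := hπ
  have hlog : 0 ≤ Real.log (Fintype.card V) := Real.log_natCast_nonneg _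
  -- The factor `2` gives every `j ∈ I` total cover at least `2`, hence at least `1` from `I` or
  -- from its complement; `J` collects the first case.
  set y : V → ℝ := fun i => 2 * Δ ^ 2 * (T * π i) with hy
  have hy0 : ∀ i, 0 ≤ y i := fun i => by
    have := hπ0 i
    positivity
  have hysum : ∀ A : Finset V, ∑ i ∈ A, y i = 2 * Δ ^ 2 * (T * ∑ i ∈ A, π i) := by
    intro A
    simp_rw [hy, ← mul_sum]
  have hycov : ∀ j ∈ I, 2 ≤ ∑ i ∈ I, y i * (if G.Adj i j then 1 else 0) +
      ∑ i ∈ Iᶜ, y i * (if G.Adj i j then 1 else 0) := by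
    intro j hj
    rw [sum_add_sum_compl]
    have h1 := mul_le_mul_of_nonneg_left (hcov j hj) (by positivity : 0 ≤ 2 * Δ ^ 2)
    have h2 : 2 * Δ ^ 2 * (1 / Δ ^ 2) = 2 := by field_simp
    rw [h2] at h1
    refine h1.trans (le_of_eq ?_)
    rw [← mul_assoc, mul_sum]
    exact sum_congr rfl fun i _ => by
      simp only [hy]
      ring
  set J := I.filter fun j => 1 ≤ ∑ i ∈ I, y i * (if G.Adj i j then 1 else 0) with hJ
  obtain ⟨D₁, hD₁, hc₁⟩ := exists_dominates_card_le G I J y hy0 fun j hj => (mem_filter.1 hj).2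
  obtain ⟨D₂, hD₂, hc₂⟩ := exists_dominates_card_le G Iᶜ (I \ J) y hy0 fun j hj => by
    obtain ⟨hjI, hjJ⟩ := mem_sdiff.1 hj
    have h1 := hycov j hjI
    have h2 : ∑ i ∈ I, y i * (if G.Adj i j then 1 else 0) < 1 := by
      by_contra! h
      exact hjJ (mem_filter.2 ⟨hjI, h⟩)
    linarith
  have hin : 0 ≤ (T : ℝ) * ∑ i ∈ I, π i := by
    have := sum_nonneg fun i (_ : i ∈ I) => hπ0 i
    positivity
  have hout : 0 ≤ (T : ℝ) * ∑ i ∈ Iᶜ, π i := by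
    have := sum_nonneg fun i (_ : i ∈ Iᶜ) => hπ0 i
    positivity
  rw [← sum_mul, ← mul_assoc] at hlt
  refine ⟨J, filter_subset _ _, D₁, D₂, hD₁, ⟨subset_univ _, hD₂.2⟩, hc₁.trans ?_, hc₂.trans ?_⟩
  · refine mul_le_mul_of_nonneg_right ?_ (by linarith)
    rw [hysum]
    have : (T : ℝ) * ∑ i ∈ I, π i ≤ T := le_of_mul_le_mul_right (by linarith) h0
    calc 2 * Δ ^ 2 * ((T : ℝ) * ∑ i ∈ I, π i) ≤ 2 * Δ ^ 2 * T := by gcongr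
      _ = _ := by ring
  · refine mul_le_mul_of_nonneg_right ?_ (by linarith)
    rw [hysum]
    have : (T : ℝ) * ∑ i ∈ Iᶜ, π i ≤ T * Δ := by
      have := mul_nonneg hin h0.le
      linarith
    calc 2 * Δ ^ 2 * ((T : ℝ) * ∑ i ∈ Iᶜ, π i) ≤ 2 * Δ ^ 2 * (T * Δ) := by gcongr
      _ = _ := by ring

theorem complexityR_le_of_lt (hN : 2 ≤ Fintype.card V) (h : complexityQ G T < T / 2) :
    complexityR G T ≤
      ENNReal.ofReal (10 * Real.log (Fintype.card V) * complexityQ G T) := by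
  have hne : Nonempty V := Fintype.card_pos_iff.1 (by omega)
  have hq0 := complexityQ_nonneg G T
  have hT0 : (0 : ℝ) < T := by linarith
  have hT : 0 < T := by exact_mod_cast hT0
  have hq : 0 < complexityQ G T := by linarith [half_le_complexityQ G hT]
  have hlog : 0.69 < Real.log (Fintype.card V) := by
    have h1 : Real.log 2 ≤ Real.log (Fintype.card V) :=
      Real.log_le_log (by norm_num) (by exact_mod_cast hN)
    linarith [Real.log_two_gt_d9]
  refine iSup_le fun I => ?_
  have hQAt := fun Δ h0 h1 => complexityQAt_le_complexityQ G T I (Δ := Δ) h0 h1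
  set q := complexityQ G T
  set l := Real.log (Fintype.card V)
  -- Chosen so that `q < T * Δ ≤ 2 * q`: the first inequality yields a feasible vector below the
  -- cap, the second bounds the covers by powers of `q`.
  set Δ := min (1 / 2) (2 * q / T) with hΔ
  have hΔ0 : 0 < Δ := lt_min (by norm_num) (by positivity)
  have hqT : q < T * Δ := by
    rw [hΔ, mul_min_of_nonneg _ _ hT0.le, lt_min_iff, mul_div_cancel₀ _ hT0.ne']
    constructor <;> linarith
  have hTq : T * Δ ≤ 2 * q := by
    rw [← mul_div_cancel₀ (2 * q) hT0.ne']
    exact mul_le_mul_of_nonneg_left (min_le_right _ _) hT0.le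
  obtain ⟨π, hπ, hlt⟩ := exists_feasible_lt G ((hQAt Δ hΔ0 (min_le_left _ _)).trans_lt hqT)
  obtain ⟨J, hJI, D₁, D₂, hD₁, hD₂, hc₁, hc₂⟩ := exists_dominates_of_feasible G hΔ0 hπ hlt
  have hx : 0 ≤ 10 * l * q := by positivity
  have hTΔ0 : 0 ≤ T * Δ := by positivity
  refine iInf₂_le_of_le J hJI (max_le ?_ ?_)
  · have h2 := rpow_mul_rpow_le_ofReal (p := 2) (T := T) two_ne_zero hx 1
      (dominatingNumber_le G hD₁) ?_
    · simpa using h2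
    calc (#D₁ : ℝ) * T ^ 1 ≤ 2 * T * Δ ^ 2 * (1 + l) * T ^ 1 := by gcongr
      _ = 2 * (T * Δ) ^ 2 * (1 + l) := by ring
      _ ≤ 2 * (2 * q) ^ 2 * (1 + l) := by gcongr
      _ = q ^ 2 * (8 * (1 + l)) := by ring
      _ ≤ q ^ 2 * (100 * l ^ 2) := by
          refine mul_le_mul_of_nonneg_left ?_ (by positivity)
          nlinarith
      _ = _ := by ring
  · have h2 := rpow_mul_rpow_le_ofReal (p := 3) (T := T) three_ne_zero hx 2
      (dominatingNumber_le G hD₂) ?_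
    · simpa using h2
    calc (#D₂ : ℝ) * T ^ 2 ≤ 2 * T * Δ ^ 3 * (1 + l) * T ^ 2 := by gcongr
      _ = 2 * (T * Δ) ^ 3 * (1 + l) := by ring
      _ ≤ 2 * (2 * q) ^ 3 * (1 + l) := by gcongr
      _ = q ^ 3 * (16 * (1 + l)) := by ring
      _ ≤ q ^ 3 * (1000 * l ^ 3) := by
          refine mul_le_mul_of_nonneg_left ?_ (by positivity)
          have : 0.47 ≤ l ^ 2 := by nlinarith
          nlinarith
      _ = _ := by ring

theorem min_complexityR_le_complexityQ (hN : 2 ≤ Fintype.card V) :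
    min ((complexityR G T).toReal / (10 * Real.log (Fintype.card V))) ((T : ℝ) / 2) ≤
      complexityQ G T := by
  rcases le_or_gt ((T : ℝ) / 2) (complexityQ G T) with h | h
  · exact (min_le_right _ _).trans h
  · refine (min_le_left _ _).trans ?_
    have hlog : 0 < Real.log (Fintype.card V) := Real.log_pos (by exact_mod_cast hN)
    rw [div_le_iff₀' (by positivity)]
    refine ENNReal.toReal_le_of_le_ofReal ?_ (complexityR_le_of_lt G hN h)
    have := complexityQ_nonneg G T
    positivity

end Compare

end GraphFeedback

end

theorem theorem1 {V : Type*} [Fintype V] (G : Digraph V) (hloop : ∀ v, G.Adj v v)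
    (hN : 2 ≤ Fintype.card V) (T : ℕ) :
    (∀ L : GraphFeedback.Learner V T,
      ∃ μ : MeasureTheory.Measure (Fin T → V → ℝ),
        MeasureTheory.IsProbabilityMeasure μ ∧
        (∀ᵐ ℓ ∂μ, ∀ t i, ℓ t i ∈ Set.Icc (0 : ℝ) 1) ∧
        GraphFeedback.complexityQ G T / 2 ^ 7 ≤ L.regret G μ) ∧
    min ((GraphFeedback.complexityR G T).toReal / (10 * Real.log (Fintype.card V)))
        ((T : ℝ) / 2) / 2 ^ 7 ≤
      GraphFeedback.complexityQ G T / 2 ^ 7 := by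
  refine ⟨fun L => GraphFeedback.exists_le_regret hloop hN L, ?_⟩
  exact div_le_div_of_nonneg_right (GraphFeedback.min_complexityR_le_complexityQ G hN) (by norm_num)
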